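/- Let $k$ be a field, let $c\ge 1$, and let $n_1,\dots,n_c\ge 1$ be integers, at least one of which is $\ge 2$. Let $I_S\subset k[x_{j,i} : 1\le j\le c,\ 1\le i\le n_j]$ be the ideal of the rational normal scroll $S=S(n_1-1,\dots,n_c-1)$, i.e. the ideal generated by the $2\times 2$ minors of the matrix $$M=[\,M_1\mid\dots\mid M_c\,],\qquad M_j=\begin{bmatrix} x_{j,1}&\dots&x_{j,n_j-1}\\ x_{j,2}&\dots&x_{j,n_j}\end{bmatrix}.$$ For $w\in\mathbb R^{n_1+\dots+n_c}$ let $\mathrm{in}_w(I_S)$ be the ideal generated by the initial forms $\mathrm{in}_w(f)$ (the sum of the terms of $f$ of maximal $w$-weight), $f\in I_S$. The Gröbner fan of $I_S$ is the set of the closures of the equivalence classes of the relation $w\sim w'\iff \mathrm{in}_w(I_S)=\mathrm{in}_{w'}(I_S)$. A state polytope of $I_S$ is a nonempty polytope in $\mathbb R^{n_1+\dots+n_c}$ whose outer normal fan equals the Gröbner fan of $I_S$. Then $I_S$ has a state polytope, and every state polytope $\mathrm{State}(I_S)$ of $I_S$ satisfies $$\dim \mathrm{State}(I_S)=n_1+\dots+n_c-c-1,$$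 and this is one less than the degree of the scroll $S$ (i.e. $\dim \mathrm{State}(I_S)+1$ equals $r!$ times the leading coefficient of the Hilbert polynomial of $k[x_{j,i}]/I_S$, where $r$ is the degree of that polynomial). -/

import Mathlib

namespace Scroll

noncomputable section

/-! ### Initial ideals with respect to real weights and the Gröbner fan -/

section Groebner

variable {σ : Type*} {k : Type*} [Field k]

open Classical in
/-- The initial form `in_w(f)`: the sum of all terms `c • x^a` of `f` for which the weight
`w · a = ∑ i, a i * w i` is maximal among the terms of `f`. -/
def initialForm (w : σ → ℝ) (f : MvPolynomial σ k) : MvPolynomial σ k :=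
  ∑ a ∈ f.support with ∀ b ∈ f.support, Finsupp.weight w b ≤ Finsupp.weight w a,
    MvPolynomial.monomial a (f.coeff a)

/-- The initial ideal `in_w(I)`, generated by the initial forms of all elements of `I`. -/
def initialIdeal (w : σ → ℝ) (I : Ideal (MvPolynomial σ k)) : Ideal (MvPolynomial σ k) :=
  Ideal.span {g | ∃ f ∈ I, g = initialForm w f}

/-- The closed Gröbner cone of `w`: the closure of the set of all weights
with the same initial ideal as `w`. -/
def groebnerCone (I : Ideal (MvPolynomial σ k)) (w : σ → ℝ) : Set (σ → ℝ) :=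
  closure {w' | initialIdeal w' I = initialIdeal w I}

/-- The Gröbner fan of a homogeneous ideal, as the set of all its closed cones. -/
def groebnerFan (I : Ideal (MvPolynomial σ k)) : Set (Set (σ → ℝ)) :=
  Set.range (groebnerCone I)

end Groebner

/-! ### Polytopes, normal fans and state polytopes -/

section Polytope

variable {σ : Type*} [Fintype σ]

/-- A (nonempty) polytope: the convex hull of a nonempty finite set of points. -/
def IsPolytope (P : Set (σ → ℝ)) : Prop :=
  ∃ V : Set (σ → ℝ), V.Finite ∧ V.Nonempty ∧ P = convexHull ℝ V

/-- The face of `P` on which the linear functional `u ↦ w · u` is maximal. -/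
def face (P : Set (σ → ℝ)) (w : σ → ℝ) : Set (σ → ℝ) :=
  {u ∈ P | ∀ v ∈ P, w ⬝ᵥ v ≤ w ⬝ᵥ u}

/-- The (outer) normal cone of `P` at a subset `F`: all `w` whose functional is maximal on `P` at
every point of `F`. -/
def normalCone (P F : Set (σ → ℝ)) : Set (σ → ℝ) :=
  {w | F ⊆ face P w}

/-- The (outer) normal fan of a polytope: the normal cones of all its nonempty faces.
The nonempty faces are the sets `face P w`, with `P = face P 0` among them. -/
def normalFan (P : Set (σ → ℝ)) : Set (Set (σ → ℝ)) :=
  Set.range fun w => normalCone P (face P w)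

/-- A state polytope of an ideal: a polytope whose normal fan is the Gröbner fan of the ideal. -/
def IsStatePolytope {k : Type*} [Field k] (I : Ideal (MvPolynomial σ k))
    (P : Set (σ → ℝ)) : Prop :=
  IsPolytope P ∧ normalFan P = groebnerFan I

/-- The dimension of a nonempty polytope, i.e. of its affine hull. -/
def polytopeDim (P : Set (σ → ℝ)) : ℕ :=
  Module.finrank ℝ (vectorSpan ℝ P)

end Polytope

/-! ### The degree of a projective variety through its Hilbert polynomial -/

section Degree

variable {σ : Type*} {k : Type*} [Field k]

/-- The Hilbert function of `k[x] / I`: the dimension of the image in the quotient of the space of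
forms of degree `m`. -/
def hilbertFunction (I : Ideal (MvPolynomial σ k)) (m : ℕ) : ℕ :=
  Module.finrank k
    ((MvPolynomial.homogeneousSubmodule σ k m).map (Ideal.Quotient.mkₐ k I).toLinearMap)

/-- `p` is the Hilbert polynomial of `k[x] / I`. -/
def IsHilbertPolynomial (I : Ideal (MvPolynomial σ k)) (p : Polynomial ℚ) : Prop :=
  ∀ᶠ m : ℕ in Filter.atTop, (hilbertFunction I m : ℚ) = p.eval (m : ℚ)

/-- The projective variety defined by the homogeneous ideal `I` has degree `e`: the Hilbert
polynomial has leading coefficient `e / r!`, where `r` is its degree. -/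
def HasProjectiveDegree (I : Ideal (MvPolynomial σ k)) (e : ℕ) : Prop :=
  ∃ p : Polynomial ℚ, IsHilbertPolynomial I p ∧
    p.leadingCoeff * (p.natDegree.factorial : ℚ) = e

end Degree

/-! ### The ideal of a rational normal scroll -/

section ScrollIdeal

variable {c : ℕ}

/-- The variables `x_{j,i}` with `j` in `Fin c` and `i` in `Fin (n j)` (counted from `0`). -/
abbrev Var (n : Fin c → ℕ) : Type :=
  Σ j : Fin c, Fin (n j)

/-- The `2`-rowed matrix `[M_1 | ... | M_c]`, where the block `M_j` has the `n j - 1` columns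
`(x_{j,i}, x_{j,i+1})`. -/
def scrollMatrix (k : Type*) [Field k] (n : Fin c → ℕ) :
    Matrix (Fin 2) (Σ j : Fin c, Fin (n j - 1)) (MvPolynomial (Var n) k) :=
  fun r p => MvPolynomial.X ⟨p.1, ⟨(p.2 : ℕ) + (r : ℕ), by omega⟩⟩

/-- The ideal of the rational normal scroll `S(n_1 - 1, ..., n_c - 1)`, generated by the
`2`-minors of its matrix. -/
def scrollIdeal (k : Type*) [Field k] (n : Fin c → ℕ) : Ideal (MvPolynomial (Var n) k) :=
  Ideal.span {d | ∃ p q : Σ j : Fin c, Fin (n j - 1),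
    d = ((scrollMatrix k n).submatrix id ![p, q]).det}

end ScrollIdeal

end

end Scroll

/-!
The ideal of the scroll is toric: it consists of the polynomials whose coefficients sum to zero over
each fibre of the grading `scrollGrading`, which records the degree of a monomial in every block and
the sum of the positions of its variables (`isToric_scrollIdeal`). The point is that the minors
identify any two monomials of the same degree, because a choice of positions can be moved to any
other one with the same sum by raising one position and lowering another
(`prod_eq_of_scroll_relations`).

For a toric ideal `I`, the initial ideal `in_w(I)` is determined by, and determines, the set of
exponents that have least `w`-weight in their fibre (`IsToric.initialIdeal_eq_iff`). A finite set of
exponents, obtained from Dickson's lemma, suffices to recover this set for every `w`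
(`exists_finset_le_notMem_fiberMin`). Hence the Minkowski sum of the negated convex hulls of the
finitely many corresponding fibres is a state polytope: the face exposed by `w` and the initial
ideal of `w` determine each other, and a normal cone of a polytope is the closure of the set of
weights exposing a given face (`IsPolytope.normalCone_face`).

The dimension of any state polytope is the codimension of the intersection of all cones of its
normal fan, which is the Gröbner fan (`polytopeDim_add_finrank`). For the Gröbner fan this
intersection is the space of weights that are constant on the fibres
(`IsToric.sInter_groebnerFan`). For the scroll these are the weights `a j + d * i`, a space of
dimension `c + 1` (`mem_range_affineWeight_iff`).

Finally, the Hilbert function at `m` counts the values of the grading in degree `m`: for every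
composition `d` of `m` into `c` parts, the position sum takes all values from `0` to
`∑ j, d j * (n j - 1)`. As each part of a composition has average `m / c`, the count is
`(m + c - 1).choose (c - 1) * (1 + D * m / c)` with `D = ∑ j, (n j - 1)`, a polynomial of degree `c`
with leading coefficient `D / c!` (`hasProjectiveDegree_scrollIdeal`).
-/

namespace Scroll

/-! ### Initial ideals of toric ideals -/

section Toric

variable {σ : Type*} {k : Type*} [Field k] {M : Type*}

open Classical in
/-- The linear functional summing the coefficients of a polynomial at the exponents in `S`. -/
noncomputable def coeffSum (k : Type*) [Field k] (S : Set (σ →₀ ℕ)) : MvPolynomial σ k →ₗ[k] k :=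
  (MvPolynomial.basisMonomials σ k).constr k fun u => if u ∈ S then 1 else 0

open Classical in
theorem coeffSum_monomial (S : Set (σ →₀ ℕ)) (u : σ →₀ ℕ) (a : k) :
    coeffSum k S (MvPolynomial.monomial u a) = if u ∈ S then a else 0 := by
  have h : (MvPolynomial.monomial u a : MvPolynomial σ k)
      = a • MvPolynomial.basisMonomials σ k u := by
    simp [MvPolynomial.smul_monomial]
  rw [h, map_smul, coeffSum, Module.Basis.constr_basis]
  simp

theorem coeffSum_apply (S : Set (σ →₀ ℕ)) [DecidablePred (· ∈ S)] (f : MvPolynomial σ k) :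
    coeffSum k S f = ∑ u ∈ f.support with u ∈ S, f.coeff u := by
  classical
  conv_lhs => rw [f.as_sum]
  simp only [map_sum, coeffSum_monomial, Finset.sum_filter]
  exact Finset.sum_congr rfl fun _ _ => by congr

theorem coeffSum_monomial_mul (S : Set (σ →₀ ℕ)) (e : σ →₀ ℕ) (f : MvPolynomial σ k) :
    coeffSum k S (MvPolynomial.monomial e 1 * f) = coeffSum k {u | e + u ∈ S} f := by
  induction f using MvPolynomial.induction_on' with
  | monomial u a => simp [MvPolynomial.monomial_mul, coeffSum_monomial]
  | add p q hp hq => rw [mul_add, map_add, map_add, hp, hq]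

/-- A linear functional vanishes on the ideal generated by `S` as soon as it vanishes on all
monomial multiples of elements of `S`. -/
theorem eq_zero_of_mem_span (L : MvPolynomial σ k →ₗ[k] k) {S : Set (MvPolynomial σ k)}
    (h : ∀ d ∈ S, ∀ e, L (MvPolynomial.monomial e 1 * d) = 0) {f : MvPolynomial σ k}
    (hf : f ∈ Ideal.span S) : L f = 0 := by
  -- The elements all of whose multiples are killed by `L` form an ideal.
  suffices H : ∀ g, L (g * f) = 0 by simpa using H 1
  induction hf using Submodule.span_induction with
  | mem d hd =>
    intro g
    induction g using MvPolynomial.induction_on' with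
    | monomial u a =>
      have : (MvPolynomial.monomial u a : MvPolynomial σ k) = a • MvPolynomial.monomial u 1 := by
        simp [MvPolynomial.smul_monomial]
      rw [this, smul_mul_assoc, map_smul, h d hd, smul_zero]
    | add p q hp hq => rw [add_mul, map_add, hp, hq, add_zero]
  | zero => simp
  | add x y _ _ hx hy => intro g; rw [mul_add, map_add, hx, hy, add_zero]
  | smul a x _ hx => intro g; rw [smul_eq_mul, ← mul_assoc]; exact hx _

/-- If an ideal contains all monomials outside `T` and identifies any two monomials of `T` in the
same fibre of `A`, then it contains every polynomial whose coefficients sum to zero over the part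
of each fibre inside `T`. -/
theorem mem_of_coeffSum_eq_zero (J : Ideal (MvPolynomial σ k)) (A : (σ →₀ ℕ) → M)
    (T : Set (σ →₀ ℕ)) (h₁ : ∀ u ∉ T, MvPolynomial.monomial u 1 ∈ J)
    (h₂ : ∀ u ∈ T, ∀ v ∈ T, A u = A v →
      MvPolynomial.monomial u 1 - MvPolynomial.monomial v 1 ∈ J)
    {f : MvPolynomial σ k} (hf : ∀ m, coeffSum k ({u | A u = m} ∩ T) f = 0) : f ∈ J := by
  classical
  have hrep : ∀ m, ∃ r : σ →₀ ℕ, ∀ u ∈ T, A u = m →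
      MvPolynomial.monomial u 1 - MvPolynomial.monomial r 1 ∈ J := by
    intro m
    by_cases hm : ∃ v ∈ T, A v = m
    · obtain ⟨v, hv, rfl⟩ := hm
      exact ⟨v, fun u hu h => h₂ u hu v hv h⟩
    · exact ⟨0, fun u hu h => (hm ⟨u, hu, h⟩).elim⟩
  choose r hr using hrep
  have hmon : ∀ (u : σ →₀ ℕ) (a : k), MvPolynomial.monomial u a
      - (if u ∈ T then MvPolynomial.monomial (r (A u)) a else 0) ∈ J := by
    intro u a
    split_ifs with hu
    · have := J.mul_mem_left (MvPolynomial.C a) (hr (A u) u hu rfl)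
      rwa [mul_sub, MvPolynomial.C_mul_monomial, MvPolynomial.C_mul_monomial, mul_one] at this
    · have := J.mul_mem_left (MvPolynomial.C a) (h₁ u hu)
      rwa [MvPolynomial.C_mul_monomial, mul_one, ← sub_zero (MvPolynomial.monomial u a)] at this
  have hsum := J.sum_mem (t := f.support) fun u _ => hmon u (f.coeff u)
  rw [Finset.sum_sub_distrib, ← f.as_sum, ← Finset.sum_filter,
    ← Finset.sum_fiberwise_of_maps_to (t := f.support.image A) (g := A)
      (fun u hu => Finset.mem_image_of_mem A (Finset.mem_filter.1 hu).1)] at hsum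
  convert hsum
  rw [Finset.sum_eq_zero, sub_zero]
  intro m _
  have := congrArg (MvPolynomial.monomial (r m)) (hf m)
  rw [coeffSum_apply, map_sum, map_zero] at this
  rw [← this, Finset.filter_filter]
  refine Finset.sum_congr (by ext u; simp [and_comm]) fun u hu => ?_
  rw [(Finset.mem_filter.1 hu).2.1.out]

theorem coeffSum_initialForm (S : Set (σ →₀ ℕ)) (w : σ → ℝ) (f : MvPolynomial σ k) :
    coeffSum k S (initialForm w f) = coeffSum k
      (S ∩ {u | ∀ b ∈ f.support, Finsupp.weight w b ≤ Finsupp.weight w u}) f := by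
  classical
  rw [initialForm, map_sum, coeffSum_apply]
  simp only [coeffSum_monomial]
  rw [← Finset.sum_filter, Finset.filter_filter]
  exact Finset.sum_congr (by ext u; simp [and_comm]) fun _ _ => rfl

/-- An ideal is toric with respect to a grading `A` of the exponents, with finite fibres, if it
consists of the polynomials whose coefficients sum to zero over each fibre of `A`. Equivalently,
it is the kernel of the map of monoid algebras induced by `A`. -/
structure IsToric [AddMonoid M] (I : Ideal (MvPolynomial σ k)) (A : (σ →₀ ℕ) →+ M) : Prop where
  finite_fiber : ∀ m, {u | A u = m}.Finite
  mem_iff : ∀ f, f ∈ I ↔ ∀ m, coeffSum k {u | A u = m} f = 0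

/-- The exponents of least weight in their fibre under `A`. -/
def fiberMin [AddMonoid M] (A : (σ →₀ ℕ) →+ M) (w : σ → ℝ) : Set (σ →₀ ℕ) :=
  {u | ∀ v, A v = A u → Finsupp.weight w u ≤ Finsupp.weight w v}

theorem mem_fiberMin_of_le [AddMonoid M] {A : (σ →₀ ℕ) →+ M} {w : σ → ℝ}
    {u v : σ →₀ ℕ} (hv : v ∈ fiberMin A w) (h : u ≤ v) : u ∈ fiberMin A w := by
  obtain ⟨e, rfl⟩ := exists_add_of_le h
  intro u' hu'
  have := hv (u' + e) (by rw [map_add, map_add, hu'])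
  rw [map_add, map_add] at this
  linarith

theorem IsToric.exists_mem_fiberMin [AddMonoid M] {I : Ideal (MvPolynomial σ k)}
    {A : (σ →₀ ℕ) →+ M} (hI : IsToric I A) (w : σ → ℝ) (u : σ →₀ ℕ) :
    ∃ v ∈ fiberMin A w, A v = A u := by
  obtain ⟨v, hv, h⟩ := Set.exists_min_image _ (Finsupp.weight w) (hI.finite_fiber (A u)) ⟨u, rfl⟩
  exact ⟨v, fun v' hv' => h v' (hv'.trans hv), hv⟩

theorem IsToric.sub_mem [AddMonoid M] {I : Ideal (MvPolynomial σ k)}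
    {A : (σ →₀ ℕ) →+ M} (hI : IsToric I A) {u v : σ →₀ ℕ} (h : A u = A v) :
    MvPolynomial.monomial u 1 - MvPolynomial.monomial v 1 ∈ I := by
  rw [hI.mem_iff]
  intro m
  rw [map_sub, coeffSum_monomial, coeffSum_monomial, sub_eq_zero]
  have : u ∈ {x | A x = m} ↔ v ∈ {x | A x = m} := by simp [h]
  by_cases hv : v ∈ {x | A x = m}
  · rw [if_pos hv, if_pos (this.2 hv)]
  · rw [if_neg hv, if_neg (mt this.1 hv)]

/-- The initial ideal of a toric ideal consists of the polynomials whose coefficients sum to zero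
over the least-weight part of each fibre. -/
theorem IsToric.mem_initialIdeal_iff [AddCancelCommMonoid M] {I : Ideal (MvPolynomial σ k)}
    {A : (σ →₀ ℕ) →+ M} (hI : IsToric I A) (w : σ → ℝ) (f : MvPolynomial σ k) :
    f ∈ initialIdeal w I ↔ ∀ m, coeffSum k ({u | A u = m} ∩ fiberMin A w) f = 0 := by
  classical
  constructor
  · intro hf m
    refine eq_zero_of_mem_span _ ?_ hf
    rintro _ ⟨g, hg, rfl⟩ e
    rw [coeffSum_monomial_mul, coeffSum_initialForm]
    -- If some term of `in_w(g)` contributes, its whole fibre in the support of `g` does.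
    by_cases h : ∃ u ∈ g.support, (A (e + u) = m ∧ e + u ∈ fiberMin A w) ∧
        ∀ b ∈ g.support, Finsupp.weight w b ≤ Finsupp.weight w u
    · obtain ⟨u, _, ⟨rfl, hmin⟩, hmax⟩ := h
      rw [← (hI.mem_iff g).1 hg (A u), coeffSum_apply, coeffSum_apply]
      refine Finset.sum_congr (Finset.filter_congr fun v hv => ?_) fun _ _ => rfl
      simp only [Set.mem_inter_iff, Set.mem_ofPred_eq, map_add, add_right_inj]
      refine ⟨fun h => h.1.1, fun h => ⟨⟨h, fun v' hv' => ?_⟩, fun b hb => ?_⟩⟩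
      · have h₁ := hmin v' (by rw [hv', map_add, map_add, h])
        have h₂ := hmax v hv
        rw [map_add] at h₁ ⊢
        linarith
      · have h₁ := hmin (e + v) (by rw [map_add, map_add, h])
        have h₂ := hmax b hb
        rw [map_add, map_add] at h₁
        linarith
    · rw [coeffSum_apply, Finset.sum_eq_zero]
      intro u hu
      rw [Finset.mem_filter] at hu
      exact (h ⟨u, hu.1, hu.2.1, hu.2.2⟩).elim
  · refine fun hf => mem_of_coeffSum_eq_zero _ A (fiberMin A w) ?_ ?_ hf
    · intro u hu
      simp only [fiberMin, Set.mem_ofPred_eq, not_forall, not_le] at hu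
      obtain ⟨v, hv, hlt⟩ := hu
      refine Ideal.subset_span ⟨_, hI.sub_mem hv.symm, ?_⟩
      have huv : u ≠ v := by rintro rfl; exact hlt.ne rfl
      have hs : (MvPolynomial.monomial u 1 - MvPolynomial.monomial v 1 :
          MvPolynomial σ k).support = {u, v} := by
        ext x
        simp only [MvPolynomial.mem_support_iff, MvPolynomial.coeff_sub,
          MvPolynomial.coeff_monomial, Finset.mem_insert, Finset.mem_singleton]
        by_cases h₁ : u = x <;> by_cases h₂ : v = x <;> simp_all [eq_comm]
      rw [initialForm, hs]
      have : ({u, v} : Finset (σ →₀ ℕ)).filter (fun a => ∀ b ∈ ({u, v} : Finset (σ →₀ ℕ)),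
          Finsupp.weight w b ≤ Finsupp.weight w a) = {u} := by
        ext x
        simp only [Finset.mem_filter, Finset.mem_insert, Finset.mem_singleton,
          forall_eq_or_imp, forall_eq]
        constructor
        · rintro ⟨rfl | rfl, h, _⟩
          · rfl
          · exact absurd h (not_le.2 hlt)
        · rintro rfl
          exact ⟨Or.inl rfl, le_rfl, hlt.le⟩
      simp only [this, Finset.sum_singleton]
      simp [MvPolynomial.coeff_monomial, huv.symm]
    · intro u hu v hv h
      refine Ideal.subset_span ⟨_, hI.sub_mem h, ?_⟩
      have hw : Finsupp.weight w u = Finsupp.weight w v := le_antisymm (hu v h.symm) (hv u h)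
      have hs : ∀ x ∈ (MvPolynomial.monomial u 1 - MvPolynomial.monomial v 1 :
          MvPolynomial σ k).support, Finsupp.weight w x = Finsupp.weight w u := by
        intro x hx
        simp only [MvPolynomial.mem_support_iff, MvPolynomial.coeff_sub,
          MvPolynomial.coeff_monomial] at hx
        by_cases h₁ : u = x
        · rw [h₁]
        · by_cases h₂ : v = x
          · rw [hw, h₂]
          · simp [h₁, h₂] at hx
      rw [initialForm, Finset.filter_true_of_mem, ← MvPolynomial.as_sum]
      intro a ha b hb
      rw [hs a ha, hs b hb]

theorem IsToric.monomial_mem_initialIdeal_iff [AddCancelCommMonoid M]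
    {I : Ideal (MvPolynomial σ k)} {A : (σ →₀ ℕ) →+ M} (hI : IsToric I A) (w : σ → ℝ)
    (u : σ →₀ ℕ) : MvPolynomial.monomial u 1 ∈ initialIdeal w I ↔ u ∉ fiberMin A w := by
  classical
  rw [hI.mem_initialIdeal_iff]
  simp [coeffSum_monomial]

/-- Two weights give the same initial ideal of a toric ideal exactly if they have the same
least-weight exponents in all fibres. -/
theorem IsToric.initialIdeal_eq_iff [AddCancelCommMonoid M] {I : Ideal (MvPolynomial σ k)}
    {A : (σ →₀ ℕ) →+ M} (hI : IsToric I A) (w w' : σ → ℝ) :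
    initialIdeal w I = initialIdeal w' I ↔ fiberMin A w = fiberMin A w' := by
  constructor
  · intro h
    ext u
    rw [← not_iff_not, ← hI.monomial_mem_initialIdeal_iff, ← hI.monomial_mem_initialIdeal_iff, h]
  · intro h
    ext f
    rw [hI.mem_initialIdeal_iff, hI.mem_initialIdeal_iff, h]

/-- A finite set of exponents, coming from a Graver basis, detects all exponents that are not of
least weight in their fibre, for all weights at once. -/
theorem exists_finset_le_notMem_fiberMin [Finite σ] [AddCancelCommMonoid M]
    (A : (σ →₀ ℕ) →+ M) : ∃ G : Finset (σ →₀ ℕ), ∀ (w : σ → ℝ), ∀ u ∉ fiberMin A w,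
      ∃ p ∈ G, p ≤ u ∧ p ∉ fiberMin A w := by
  classical
  -- By Dickson's lemma, finitely many pairs of distinct exponents in a common fibre are minimal.
  set S : Set ((σ →₀ ℕ) × (σ →₀ ℕ)) := {x | A x.1 = A x.2 ∧ x.1 ≠ x.2}
  have hfin : {x | Minimal (· ∈ S) x}.Finite :=
    WellQuasiOrderedLE.finite_of_isAntichain (setOfPred_minimal_antichain _)
  refine ⟨hfin.toFinset.image Prod.fst, fun w u hu => ?_⟩
  simp only [fiberMin, Set.mem_ofPred_eq, not_forall, not_le] at hu
  obtain ⟨v, hv, hlt⟩ := hu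
  obtain ⟨x, hx⟩ : ∃ x : (σ →₀ ℕ) × (σ →₀ ℕ), x = (u, v) := ⟨_, rfl⟩
  induction x using WellFoundedLT.induction generalizing u v with
  | ind x ih =>
    subst hx
    have huv : (u, v) ∈ S := ⟨hv.symm, fun h => hlt.ne (congrArg _ h.symm)⟩
    obtain ⟨⟨p, q⟩, hle, hmin⟩ := (Set.isPWO_of_wellQuasiOrderedLE S).exists_le_minimal huv
    obtain ⟨a, rfl⟩ := exists_add_of_le hle.1
    obtain ⟨b, rfl⟩ := exists_add_of_le hle.2
    have hpq : A p = A q := hmin.prop.1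
    -- Split off a minimal pair `(p, q)`: either it or the remaining smaller pair `(a, b)` still
    -- decreases the weight.
    by_cases h : Finsupp.weight w q < Finsupp.weight w p
    · refine ⟨p, ?_, self_le_add_right p a, fun hp => absurd (hp q hpq.symm) (not_le.2 h)⟩
      rw [Finset.mem_image]
      exact ⟨(p, q), hfin.mem_toFinset.2 hmin, rfl⟩
    · have hlt' : Finsupp.weight w b < Finsupp.weight w a := by
        rw [map_add, map_add] at hlt
        linarith
      have hab : A b = A a := by
        rw [map_add, map_add, hpq] at hv
        exact add_left_cancel hv
      have hne : (a, b) < (p + a, q + b) := by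
        refine lt_of_le_of_ne ⟨self_le_add_left a p, self_le_add_left b q⟩ fun h' => ?_
        rw [Prod.mk.injEq, right_eq_add, right_eq_add] at h'
        exact hmin.prop.2 (h'.1.trans h'.2.symm)
      obtain ⟨p', hp', hle', hn⟩ := ih (a, b) hne a b hab hlt' rfl
      exact ⟨p', hp', hle'.trans (self_le_add_left a p), hn⟩

end Toric

/-! ### Normal fans of polytopes -/

section Polytope

variable {σ : Type*} [Fintype σ]

theorem dotProduct_le_of_mem_convexHull {V : Set (σ → ℝ)} {w : σ → ℝ} {M : ℝ}
    (h : ∀ v ∈ V, w ⬝ᵥ v ≤ M) {x : σ → ℝ} (hx : x ∈ convexHull ℝ V) : w ⬝ᵥ x ≤ M := by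
  have hc : Convex ℝ {x : σ → ℝ | w ⬝ᵥ x ≤ M} :=
    convex_halfSpace_le ⟨fun x y => dotProduct_add w x y, fun c x => dotProduct_smul c w x⟩ M
  exact convexHull_min h hc hx

theorem mem_face_convexHull_iff {V : Set (σ → ℝ)} {w x : σ → ℝ} (hx : x ∈ V) :
    x ∈ face (convexHull ℝ V) w ↔ ∀ v ∈ V, w ⬝ᵥ v ≤ w ⬝ᵥ x :=
  ⟨fun h v hv => h.2 v (subset_convexHull ℝ V hv), fun h =>
    ⟨subset_convexHull ℝ V hx, fun _ hv => dotProduct_le_of_mem_convexHull h hv⟩⟩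

/-- A face of a polytope is spanned by the vertices on it, hence lies in any other face that
contains these vertices. -/
theorem face_convexHull_subset {V : Set (σ → ℝ)} (hV : V.Finite) {w w' : σ → ℝ}
    (h : ∀ v ∈ V, v ∈ face (convexHull ℝ V) w → v ∈ face (convexHull ℝ V) w') :
    face (convexHull ℝ V) w ⊆ face (convexHull ℝ V) w' := by
  rintro x ⟨hx, hmax⟩
  refine ⟨hx, fun y hy => ?_⟩
  obtain ⟨s, rfl⟩ := hV.exists_finset_coe
  obtain ⟨a, ha, ha₁, rfl⟩ := Finset.mem_convexHull'.1 hx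
  have hzero : ∀ v ∈ s, a v * (w ⬝ᵥ (∑ u ∈ s, a u • u) - w ⬝ᵥ v) = 0 := by
    refine (Finset.sum_eq_zero_iff_of_nonneg fun v hv => mul_nonneg (ha v hv)
      (sub_nonneg.2 (hmax v (subset_convexHull ℝ _ hv)))).1 ?_
    simp only [mul_sub, Finset.sum_sub_distrib, ← Finset.sum_mul, ha₁, one_mul, dotProduct_sum,
      dotProduct_smul, smul_eq_mul, sub_self]
  calc w' ⬝ᵥ y = ∑ v ∈ s, a v * (w' ⬝ᵥ y) := by rw [← Finset.sum_mul, ha₁, one_mul]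
    _ ≤ ∑ v ∈ s, a v * (w' ⬝ᵥ v) := by
        refine Finset.sum_le_sum fun v hv => ?_
        rcases mul_eq_zero.1 (hzero v hv) with h0 | h0
        · simp [h0]
        · refine mul_le_mul_of_nonneg_left ((h v hv ⟨subset_convexHull ℝ _ hv, ?_⟩).2 y hy)
            (ha v hv)
          rw [← sub_eq_zero.1 h0]
          exact hmax
    _ = w' ⬝ᵥ ∑ v ∈ s, a v • v := by
        simp only [dotProduct_sum, dotProduct_smul, smul_eq_mul]

theorem IsPolytope.face_nonempty {P : Set (σ → ℝ)} (hP : IsPolytope P) (w : σ → ℝ) :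
    (face P w).Nonempty := by
  obtain ⟨V, hV, hne, rfl⟩ := hP
  obtain ⟨v, hv, h⟩ := Set.exists_max_image V (fun v => w ⬝ᵥ v) hV hne
  exact ⟨v, (mem_face_convexHull_iff hv).2 h⟩

theorem isClosed_normalCone {P F : Set (σ → ℝ)} (hF : F ⊆ P) : IsClosed (normalCone P F) := by
  have : normalCone P F = ⋂ x ∈ F, ⋂ v ∈ P, {w | w ⬝ᵥ v ≤ w ⬝ᵥ x} := by
    ext w
    simp only [normalCone, face, Set.mem_ofPred_eq, Set.mem_iInter, Set.subset_def]
    exact ⟨fun h x hx v hv => (h x hx).2 v hv, fun h x hx => ⟨hF hx, h x hx⟩⟩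
  rw [this]
  refine isClosed_biInter fun x _ => isClosed_biInter fun v _ => isClosed_le ?_ ?_
  · exact Continuous.dotProduct continuous_id continuous_const
  · exact Continuous.dotProduct continuous_id continuous_const

theorem mem_closure_of_forall_pos_add_smul {τ : Type*} {S : Set (τ → ℝ)} {v w : τ → ℝ}
    (h : ∀ ε : ℝ, 0 < ε → v + ε • w ∈ S) : v ∈ closure S := by
  have hc : Continuous fun ε : ℝ => v + ε • w := by fun_prop
  have ht : Filter.Tendsto (fun ε : ℝ => v + ε • w) (nhdsWithin 0 (Set.Ioi 0)) (nhds v) := by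
    have := (hc.tendsto 0).mono_left (nhdsWithin_le_nhds (s := Set.Ioi 0))
    simpa using this
  exact mem_closure_of_tendsto ht (Filter.eventually_of_mem self_mem_nhdsWithin h)

/-- A normal cone of a polytope is the closure of the set of weights exposing the same face. -/
theorem IsPolytope.normalCone_face {P : Set (σ → ℝ)} (hP : IsPolytope P) (w : σ → ℝ) :
    normalCone P (face P w) = closure {w' | face P w' = face P w} := by
  apply subset_antisymm
  · intro v hv
    -- As the face of `w` lies in that of `v`, a point is maximal for `v + ε • w` exactly if it is
    -- maximal for `v` and for `w`.
    have hmem : ∀ ε : ℝ, 0 < ε → v + ε • w ∈ {w' | face P w' = face P w} := by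
      intro ε hε
      obtain ⟨z, hz⟩ := hP.face_nonempty w
      have hz' : z ∈ face P v := hv hz
      ext x
      constructor
      · rintro ⟨hx, h⟩
        refine ⟨hx, fun y hy => (hz.2 y hy).trans ?_⟩
        have h₁ := h z hz.1
        have h₂ := hz'.2 x hx
        simp only [add_dotProduct, smul_dotProduct, smul_eq_mul] at h₁
        exact le_of_mul_le_mul_left (by linarith) hε
      · intro hx
        refine ⟨hx.1, fun y hy => ?_⟩
        simp only [add_dotProduct, smul_dotProduct, smul_eq_mul]
        exact add_le_add ((hv hx).2 y hy) (mul_le_mul_of_nonneg_left (hx.2 y hy) hε.le)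
    exact mem_closure_of_forall_pos_add_smul hmem
  · refine closure_minimal ?_ (isClosed_normalCone fun _ h => h.1)
    intro w' hw'
    exact (show face P w' = face P w from hw').ge

theorem sInter_normalFan (P : Set (σ → ℝ)) :
    ⋂₀ normalFan P = {w | ∀ x ∈ P, ∀ y ∈ P, w ⬝ᵥ x = w ⬝ᵥ y} := by
  ext w
  simp only [normalFan, Set.mem_sInter, Set.forall_mem_range, Set.mem_ofPred_eq]
  constructor
  · intro h x hx y hy
    have hw : P ⊆ face P w := fun z hz => h 0 ⟨hz, fun v _ => by simp⟩
    exact le_antisymm ((hw hy).2 x hx) ((hw hx).2 y hy)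
  · exact fun h v x hx => ⟨hx.1, fun y hy => (h y hy x hx.1).le⟩

/-- The dimension of a polytope is the codimension of the smallest cone of its normal fan. -/
theorem polytopeDim_add_finrank {P : Set (σ → ℝ)} {H : Submodule ℝ (σ → ℝ)}
    (h : ⋂₀ normalFan P = H) :
    polytopeDim P + Module.finrank ℝ H = Fintype.card σ := by
  classical
  rw [← Module.finrank_fintype_fun_eq_card ℝ (η := σ),
    ← Subspace.finrank_add_finrank_dualAnnihilator_eq (vectorSpan ℝ P), polytopeDim]
  congr 1
  have hH : H.map (dotProductEquiv ℝ σ).toLinearMap = (vectorSpan ℝ P).dualAnnihilator := by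
    ext φ
    obtain ⟨w, rfl⟩ := (dotProductEquiv ℝ σ).surjective φ
    have hw : w ∈ H ↔ ∀ x ∈ P, ∀ y ∈ P, w ⬝ᵥ x = w ⬝ᵥ y := by
      rw [← SetLike.mem_coe, ← h, sInter_normalFan]
      rfl
    rw [Submodule.mem_dualAnnihilator, Submodule.mem_map_equiv, LinearEquiv.symm_apply_apply, hw]
    constructor
    · intro hw x hx
      induction hx using Submodule.span_induction with
      | mem x hx =>
        obtain ⟨a, ha, b, hb, rfl⟩ := Set.mem_vsub.1 hx
        simp [dotProduct_sub, hw a ha b hb]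
      | zero => simp
      | add x y _ _ hx hy => rw [map_add, hx, hy, add_zero]
      | smul c x _ hx => rw [map_smul, hx, smul_zero]
    · intro hw x hx y hy
      have := hw (x -ᵥ y) (vsub_mem_vectorSpan ℝ hx hy)
      simpa [dotProduct_sub, sub_eq_zero] using this
  rw [← hH]
  exact (LinearEquiv.finrank_map_eq (dotProductEquiv ℝ σ) H).symm

end Polytope

/-! ### State polytopes of toric ideals -/

section StatePolytope

variable {σ : Type*} [Fintype σ] {k : Type*} [Field k] {M : Type*} [AddCancelCommMonoid M]
  {I : Ideal (MvPolynomial σ k)} {A : (σ →₀ ℕ) →+ M}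

/-- An exponent vector as a point of `ℝ^σ`. -/
def expPoint (u : σ →₀ ℕ) : σ → ℝ := fun i => u i

theorem dotProduct_expPoint (w : σ → ℝ) (u : σ →₀ ℕ) : w ⬝ᵥ expPoint u = Finsupp.weight w u := by
  rw [Finsupp.weight_apply, Finsupp.sum_fintype _ _ (by simp), dotProduct]
  exact Finset.sum_congr rfl fun i _ => by simp [expPoint, mul_comm]

/-- A toric ideal has a state polytope: the Minkowski sum of the negated convex hulls of the fibres
of the exponents in `exists_finset_le_notMem_fiberMin`. -/
theorem IsToric.exists_isStatePolytope (hI : IsToric I A) :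
    ∃ P : Set (σ → ℝ), IsStatePolytope I P := by
  classical
  obtain ⟨G, hG⟩ := exists_finset_le_notMem_fiberMin A
  -- `Φ` consists of the choices of one exponent in the fibre of each member of `G`.
  set Φ : Set (G → (σ →₀ ℕ)) := {g | ∀ p, A (g p) = A p}
  have hΦ : Φ.Finite := by
    convert Set.Finite.pi' fun p : G => hI.finite_fiber (A p)
    exact Iff.rfl
  set pt : (G → (σ →₀ ℕ)) → σ → ℝ := fun g => -∑ p, expPoint (g p)
  have hpt : ∀ w g, w ⬝ᵥ pt g = -∑ p, Finsupp.weight w (g p) := fun w g => by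
    simp only [pt, dotProduct_neg, dotProduct_sum, dotProduct_expPoint]
  set P := convexHull ℝ (pt '' Φ)
  have hP : IsPolytope P := ⟨_, hΦ.image pt, ⟨_, _, fun p => rfl, rfl⟩, rfl⟩
  -- A vertex lies on the face exposed by `w` exactly if all its summands have least weight.
  have hface : ∀ w, ∀ g ∈ Φ, pt g ∈ face P w ↔ ∀ p, g p ∈ fiberMin A w := by
    intro w g hg
    rw [mem_face_convexHull_iff (Set.mem_image_of_mem pt hg)]
    constructor
    · intro h p u hu
      have hrest : ∑ q ∈ Finset.univ.erase p, Finsupp.weight w (Function.update g p u q)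
          = ∑ q ∈ Finset.univ.erase p, Finsupp.weight w (g q) :=
        Finset.sum_congr rfl fun q hq => by rw [Function.update_of_ne (Finset.ne_of_mem_erase hq)]
      have h' := h (pt (Function.update g p u)) ⟨_, fun q => ?_, rfl⟩
      · rw [hpt, hpt, neg_le_neg_iff, ← Finset.add_sum_erase _ _ (Finset.mem_univ p),
          ← Finset.add_sum_erase _ _ (Finset.mem_univ p), Function.update_self,
          hrest] at h'
        linarith
      · by_cases hq : q = p
        · subst hq
          rw [Function.update_self, hu, hg q]
        · rw [Function.update_of_ne hq, hg q]
    · rintro h _ ⟨g', hg', rfl⟩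
      rw [hpt, hpt, neg_le_neg_iff]
      exact Finset.sum_le_sum fun p _ => h p _ ((hg' p).trans (hg p).symm)
  have hsub : ∀ w w', face P w = face P w' → ∀ u, u ∉ fiberMin A w → u ∉ fiberMin A w' := by
    intro w w' h u hu hu'
    obtain ⟨p, hp, hle, hn⟩ := hG w u hu
    have hp' := mem_fiberMin_of_le hu' hle
    -- A vertex on the face exposed by `w'` whose summand at `p` is `p` itself.
    choose g hg hgA using fun q : G => hI.exists_mem_fiberMin w' (q : σ →₀ ℕ)
    have hmem : Function.update g ⟨p, hp⟩ p ∈ Φ := fun q => by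
      by_cases hq : q = ⟨p, hp⟩
      · subst hq
        rw [Function.update_self]
      · rw [Function.update_of_ne hq, hgA]
    have := (hface w' _ hmem).2 fun q => by
      by_cases hq : q = ⟨p, hp⟩
      · subst hq
        rwa [Function.update_self]
      · rw [Function.update_of_ne hq]
        exact hg q
    rw [← h, hface w _ hmem] at this
    have := this ⟨p, hp⟩
    rw [Function.update_self] at this
    exact hn this
  have hfaceEq : ∀ w w', face P w = face P w' ↔ initialIdeal w I = initialIdeal w' I := by
    intro w w'
    rw [hI.initialIdeal_eq_iff]
    constructor
    · intro h
      ext u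
      exact not_iff_not.1 ⟨hsub w w' h u, hsub w' w h.symm u⟩
    · have key : ∀ w w', fiberMin A w = fiberMin A w' → face P w ⊆ face P w' := by
        intro w w' h
        apply face_convexHull_subset (hΦ.image pt)
        rintro _ ⟨g, hg, rfl⟩ hgw
        rw [hface _ g hg] at hgw ⊢
        rwa [← h]
      exact fun h => (key w w' h).antisymm (key w' w h.symm)
  refine ⟨P, hP, ?_⟩
  rw [normalFan, groebnerFan]
  congr 1
  ext1 w
  rw [hP.normalCone_face, groebnerCone]
  simp only [hfaceEq]

/-- The smallest cone of the Gröbner fan of a toric ideal is the space of weights that are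
constant on the fibres. -/
theorem IsToric.sInter_groebnerFan (hI : IsToric I A) {H : Submodule ℝ (σ → ℝ)}
    (hH : ∀ w, w ∈ H ↔ ∀ u v, A u = A v → Finsupp.weight w u = Finsupp.weight w v) :
    ⋂₀ groebnerFan I = H := by
  have hweight : ∀ (v w : σ → ℝ) (ε : ℝ) (u : σ →₀ ℕ),
      Finsupp.weight (v + ε • w) u = Finsupp.weight v u + ε * Finsupp.weight w u := by
    intro v w ε u
    simp only [← dotProduct_expPoint, add_dotProduct, smul_dotProduct, smul_eq_mul]
  ext v
  simp only [groebnerFan, Set.mem_sInter, Set.forall_mem_range, SetLike.mem_coe]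
  constructor
  · intro h
    have h0 : groebnerCone I (0 : σ → ℝ) ⊆ H := by
      refine closure_minimal ?_ H.closed_of_finiteDimensional
      intro w hw
      have hw' := (hI.initialIdeal_eq_iff _ _).1 hw
      have hall : ∀ u, u ∈ fiberMin A w := fun u => by
        rw [hw']
        intro u' _
        simp [← dotProduct_expPoint]
      exact (hH w).2 fun u u' huu' => le_antisymm (hall u u' huu'.symm) (hall u' u huu')
    exact h0 (h 0)
  · intro hv w
    rw [hH] at hv
    -- Adding `v` to a weight changes no comparison within a fibre.
    refine mem_closure_of_forall_pos_add_smul (w := w) fun ε hε => ?_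
    refine (hI.initialIdeal_eq_iff _ _).2 ?_
    ext u
    refine forall₂_congr fun u' hu' => ?_
    rw [hweight, hweight, hv _ _ hu', add_le_add_iff_left, mul_le_mul_iff_right₀ hε]

end StatePolytope

/-! ### The ideal of a scroll is toric -/

section ScrollToric

@[to_additive]
theorem prod_eq_prod_of_pair {ι Q : Type*} [Fintype ι] [DecidableEq ι] [CommMonoid Q]
    {f g : ι → Q} {s t : ι} (hst : s ≠ t) (h : f s * f t = g s * g t)
    (hrest : ∀ x, x ≠ s → x ≠ t → f x = g x) : ∏ x, f x = ∏ x, g x := by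
  have ht : t ∈ Finset.univ.erase s := Finset.mem_erase.2 ⟨hst.symm, Finset.mem_univ _⟩
  rw [← Finset.mul_prod_erase _ f (Finset.mem_univ s), ← Finset.mul_prod_erase _ f ht,
    ← Finset.mul_prod_erase _ g (Finset.mem_univ s), ← Finset.mul_prod_erase _ g ht,
    ← mul_assoc, ← mul_assoc, h]
  congr 1
  refine Finset.prod_congr rfl fun x hx => ?_
  rw [Finset.mem_erase, Finset.mem_erase] at hx
  exact hrest x hx.2.1 hx.1

/-- In the presence of the scroll relations, a product of variables depends only on the multiset of
their blocks and on the sum of their positions: raising one position and lowering another moves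
one choice of positions to any other with the same sum. -/
theorem prod_eq_of_scroll_relations {ι γ Q : Type*} [Fintype ι] [CommMonoid Q] (N : γ → ℕ)
    (y : γ → ℕ → Q) (hy : ∀ j l i m, i + 1 < N j → m + 1 < N l →
      y j i * y l (m + 1) = y j (i + 1) * y l m)
    (b : ι → γ) (h h' : ι → ℕ) (hN : ∀ s, h s < N (b s)) (hN' : ∀ s, h' s < N (b s))
    (hsum : ∑ s, h s = ∑ s, h' s) : ∏ s, y (b s) (h s) = ∏ s, y (b s) (h' s) := by
  classical
  obtain ⟨d, hd⟩ : ∃ d, d = ∑ s, (h s - h' s) := ⟨_, rfl⟩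
  induction d using Nat.strong_induction_on generalizing h with
  | _ d ih =>
    by_cases hle : ∀ s, h s ≤ h' s
    · have := (Finset.sum_eq_sum_iff_of_le fun s _ => hle s).1 hsum
      exact Finset.prod_congr rfl fun s hs => by rw [this s hs]
    · push Not at hle
      obtain ⟨t, ht⟩ := hle
      obtain ⟨s, hs⟩ : ∃ s, h s < h' s := by
        by_contra! hge
        exact (Finset.sum_lt_sum (fun s _ => hge s) ⟨t, Finset.mem_univ t, ht⟩).ne hsum.symm
      have hst : s ≠ t := by rintro rfl; omega
      -- Raise the position of `s` and lower that of `t`.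
      set g := Function.update (Function.update h t (h t - 1)) s (h s + 1)
      have hgs : g s = h s + 1 := by simp [g]
      have hgt : g t = h t - 1 := by simp [g, hst.symm]
      have hg : ∀ x, x ≠ s → x ≠ t → g x = h x := fun x hxs hxt => by simp [g, hxs, hxt]
      have hmove : ∏ x, y (b x) (h x) = ∏ x, y (b x) (g x) := by
        refine prod_eq_prod_of_pair hst ?_ fun x hxs hxt => by rw [hg x hxs hxt]
        obtain ⟨m, hm⟩ : ∃ m, h t = m + 1 := ⟨h t - 1, by omega⟩
        rw [hgs, hgt, hm, Nat.add_sub_cancel]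
        exact hy _ _ _ _ (by have := hN' s; omega) (hm ▸ hN t)
      rw [hmove]
      refine ih _ ?_ g (fun x => ?_) ?_ rfl
      · rw [hd]
        refine Finset.sum_lt_sum (fun x _ => ?_) ⟨t, Finset.mem_univ t, by omega⟩
        by_cases hxs : x = s
        · subst hxs; omega
        · by_cases hxt : x = t
          · subst hxt; omega
          · rw [hg x hxs hxt]
      · by_cases hxs : x = s
        · subst hxs; have := hN' x; omega
        · by_cases hxt : x = t
          · subst hxt; have := hN x; omega
          · rw [hg x hxs hxt]; exact hN x
      · rw [← hsum]
        exact sum_eq_sum_of_pair hst (by omega) hg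

variable {c : ℕ} (n : Fin c → ℕ)

/-- The grading of the scroll: the degrees of a monomial in the blocks, and the sum of the positions
of its variables within their blocks. -/
noncomputable def scrollGrading : (Var n →₀ ℕ) →+ (Fin c → ℕ) × ℕ :=
  Finsupp.weight fun p : Var n => ((Pi.single p.1 1 : Fin c → ℕ), (p.2 : ℕ))

theorem scrollGrading_single (p : Var n) :
    scrollGrading n (Finsupp.single p 1) = (Pi.single p.1 1, (p.2 : ℕ)) := by
  simp [scrollGrading, Finsupp.weight_single]

theorem scrollGrading_fst (u : Var n →₀ ℕ) (j : Fin c) :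
    (scrollGrading n u).1 j = ∑ p, u p * (Pi.single p.1 1 : Fin c → ℕ) j := by
  rw [scrollGrading, Finsupp.weight_apply, Finsupp.sum_fintype _ _ (by simp), Prod.fst_sum,
    Finset.sum_apply]
  rfl

theorem scrollGrading_snd (u : Var n →₀ ℕ) :
    (scrollGrading n u).2 = ∑ p : Var n, u p * (p.2 : ℕ) := by
  rw [scrollGrading, Finsupp.weight_apply, Finsupp.sum_fintype _ _ (by simp), Prod.snd_sum]
  rfl

theorem le_scrollGrading_fst (u : Var n →₀ ℕ) (p : Var n) : u p ≤ (scrollGrading n u).1 p.1 := by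
  rw [scrollGrading_fst]
  refine le_trans ?_ (Finset.single_le_sum (f := fun q : Var n =>
    u q * (Pi.single q.1 1 : Fin c → ℕ) p.1) (fun _ _ => Nat.zero_le _) (Finset.mem_univ p))
  simp

theorem finite_scrollGrading_fiber (m : (Fin c → ℕ) × ℕ) : {u | scrollGrading n u = m}.Finite := by
  refine (Set.finite_Iic (Finsupp.equivFunOnFinite.symm fun p : Var n => m.1 p.1)).subset ?_
  rintro u rfl p
  exact le_scrollGrading_fst n u p

theorem monomial_one_eq_prod {σ R : Type*} [Fintype σ] [CommSemiring R] (u : σ →₀ ℕ) :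
    (MvPolynomial.monomial u 1 : MvPolynomial σ R)
      = ∏ s : Σ p, Fin (u p), MvPolynomial.X s.1 := by
  rw [MvPolynomial.monomial_eq, Finsupp.prod_fintype _ _ (by simp), Fintype.prod_sigma]
  simp

variable (k : Type*) [Field k]

theorem scrollIdeal_generator (p q : Σ j : Fin c, Fin (n j - 1)) :
    ((scrollMatrix k n).submatrix id ![p, q]).det =
      MvPolynomial.X ⟨p.1, ⟨p.2, by omega⟩⟩ * MvPolynomial.X ⟨q.1, ⟨q.2 + 1, by omega⟩⟩
      - MvPolynomial.X ⟨q.1, ⟨q.2, by omega⟩⟩ * MvPolynomial.X ⟨p.1, ⟨p.2 + 1, by omega⟩⟩ := by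
  rw [Matrix.det_fin_two]
  rfl

/-- Monomials of the same scroll degree agree modulo the scroll ideal. -/
theorem monomial_sub_mem_scrollIdeal {u v : Var n →₀ ℕ}
    (huv : scrollGrading n u = scrollGrading n v) :
    MvPolynomial.monomial u 1 - MvPolynomial.monomial v 1 ∈ scrollIdeal k n := by
  classical
  rw [← Ideal.Quotient.eq]
  set π := Ideal.Quotient.mk (scrollIdeal k n)
  -- The residue classes of the variables, with the value `0` outside the blocks.
  set y : Fin c → ℕ → MvPolynomial (Var n) k ⧸ scrollIdeal k n := fun j i =>
    if h : i < n j then π (MvPolynomial.X ⟨j, ⟨i, h⟩⟩) else 0 with hydef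
  have hy : ∀ j l i m, i + 1 < n j → m + 1 < n l →
      y j i * y l (m + 1) = y j (i + 1) * y l m := by
    intro j l i m hi hm
    simp only [hydef, hi, hm, (Nat.lt_succ_self _).trans hi, (Nat.lt_succ_self _).trans hm,
      dif_pos, ← map_mul]
    rw [Ideal.Quotient.eq]
    refine Ideal.subset_span ⟨⟨j, ⟨i, by omega⟩⟩, ⟨l, ⟨m, by omega⟩⟩, ?_⟩
    rw [scrollIdeal_generator]
    exact congrArg _ (mul_comm _ _)
  have hmon : ∀ u : Var n →₀ ℕ, π (MvPolynomial.monomial u 1)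
      = ∏ s : Σ p, Fin (u p), y s.1.1 s.1.2 := by
    intro u
    rw [monomial_one_eq_prod, map_prod]
    exact Finset.prod_congr rfl fun s _ => by simp [hydef]
  have hcard : ∀ (u : Var n →₀ ℕ) (j : Fin c),
      Fintype.card {s : Σ p, Fin (u p) // s.1.1 = j} = (scrollGrading n u).1 j := by
    intro u j
    rw [Fintype.card_subtype, Finset.card_filter, Fintype.sum_sigma, scrollGrading_fst]
    refine Finset.sum_congr rfl fun p _ => ?_
    simp [Pi.single_apply, eq_comm]
  have hpos : ∀ u : Var n →₀ ℕ,
      ∑ s : Σ p, Fin (u p), (s.1.2 : ℕ) = (scrollGrading n u).2 := by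
    intro u
    rw [Fintype.sum_sigma, scrollGrading_snd]
    simp
  -- Equal block degrees allow the factors of the two monomials to be matched block by block.
  let e : (Σ p, Fin (u p)) ≃ (Σ p, Fin (v p)) :=
    Equiv.ofFiberEquiv (f := fun s => s.1.1) (g := fun s => s.1.1) fun j =>
      Fintype.equivOfCardEq (by rw [hcard, hcard, huv])
  have he : ∀ s, (e s).1.1 = s.1.1 := Equiv.ofFiberEquiv_map
    (f := fun s : Σ p, Fin (u p) => s.1.1) (g := fun s : Σ p, Fin (v p) => s.1.1) _
  rw [hmon, hmon, ← e.prod_comp]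
  simp only [he]
  refine prod_eq_of_scroll_relations n y hy (fun s : Σ p, Fin (u p) => s.1.1) _ _ (fun s => s.1.2.2)
    (fun s => (e s).1.2.2.trans_eq (congrArg n (he s))) ?_
  rw [hpos, e.sum_comp (fun s : Σ p, Fin (v p) => (s.1.2 : ℕ)), hpos, huv]

/-- The minors of a scroll generate a toric ideal: each minor is a difference of two monomials of
the same degree, and `monomial_sub_mem_scrollIdeal` gives all such differences. -/
theorem isToric_scrollIdeal : IsToric (scrollIdeal k n) (scrollGrading n) where
  finite_fiber := finite_scrollGrading_fiber n
  mem_iff f := by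
    classical
    constructor
    · intro hf m
      refine eq_zero_of_mem_span _ ?_ hf
      rintro _ ⟨p, q, rfl⟩ e
      rw [scrollIdeal_generator, mul_sub]
      simp only [MvPolynomial.X, MvPolynomial.monomial_mul, map_sub, coeffSum_monomial, mul_one,
        Set.mem_ofPred_eq, map_add, scrollGrading_single]
      rw [sub_eq_zero]
      have : ((Pi.single p.1 1, (p.2 : ℕ)) + (Pi.single q.1 1, (q.2 : ℕ) + 1) :
          (Fin c → ℕ) × ℕ) = (Pi.single q.1 1, (q.2 : ℕ)) + (Pi.single p.1 1, (p.2 : ℕ) + 1) := by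
        ext <;> simp <;> omega
      simp only [this]
    · intro hf
      refine mem_of_coeffSum_eq_zero _ (scrollGrading n) Set.univ (fun u hu => (hu trivial).elim)
        (fun u _ v _ h => monomial_sub_mem_scrollIdeal n k h) fun m => ?_
      rw [Set.inter_univ]
      exact hf m

end ScrollToric

/-! ### The dimension of a state polytope of a scroll -/

section Dimension

variable {c : ℕ} (n : Fin c → ℕ)

/-- The weight on the variables of a scroll that is `a j + d * i` on the variable at position `i` of
block `j`. -/
def affineWeight : ((Fin c → ℝ) × ℝ) →ₗ[ℝ] (Var n → ℝ) where
  toFun x p := x.1 p.1 + x.2 * (p.2 : ℕ)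
  map_add' x y := by ext p; simp; ring
  map_smul' r x := by ext p; simp; ring

theorem affineWeight_injective (hn : ∀ j, 1 ≤ n j) (hn' : ∃ j, 2 ≤ n j) :
    Function.Injective (affineWeight n) := by
  rw [injective_iff_map_eq_zero]
  rintro ⟨a, d⟩ h
  have ha : a = 0 := by
    ext j
    simpa [affineWeight] using congrFun h ⟨j, ⟨0, hn j⟩⟩
  obtain ⟨j, hj⟩ := hn'
  have hd := congrFun h ⟨j, ⟨1, hj⟩⟩
  simp [affineWeight, ha] at hd
  rw [ha, hd]
  rfl

/-- The weights that are constant on the fibres of the scroll grading are the weights whose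
consecutive differences within the blocks are all the same. -/
theorem mem_range_affineWeight_iff (hn' : ∃ j, 2 ≤ n j) (w : Var n → ℝ) :
    w ∈ LinearMap.range (affineWeight n) ↔ ∀ u v, scrollGrading n u = scrollGrading n v →
      Finsupp.weight w u = Finsupp.weight w v := by
  constructor
  · rintro ⟨x, rfl⟩
    let φ : (Fin c → ℕ) × ℕ →+ ℝ :=
      { toFun := fun m => ∑ j, m.1 j * x.1 j + m.2 * x.2
        map_zero' := by simp
        map_add' := fun m m' => by
          simp only [Prod.fst_add, Prod.snd_add, Pi.add_apply, Nat.cast_add, add_mul,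
            Finset.sum_add_distrib]
          ring }
    have hφ : ∀ u, Finsupp.weight (affineWeight n x) u = φ (scrollGrading n u) := by
      intro u
      rw [scrollGrading, Finsupp.weight_apply, Finsupp.weight_apply, Finsupp.sum, Finsupp.sum,
        map_sum]
      refine Finset.sum_congr rfl fun p _ => ?_
      rw [map_nsmul]
      congr 1
      simp [φ, affineWeight, Pi.single_apply, mul_comm]
    intro u v h
    rw [hφ, hφ, h]
  · intro h
    obtain ⟨l, hl⟩ := hn'
    refine ⟨(fun j => if hj : 0 < n j then w ⟨j, ⟨0, hj⟩⟩ else 0,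
      w ⟨l, ⟨1, hl⟩⟩ - w ⟨l, ⟨0, by omega⟩⟩), ?_⟩
    ext ⟨j, i, hi⟩
    have h0 : 0 < n j := by omega
    simp only [affineWeight, LinearMap.coe_mk, AddHom.coe_mk, h0, dif_pos]
    induction i with
    | zero => simp
    | succ i ih =>
      have := h (Finsupp.single ⟨j, ⟨i, by omega⟩⟩ 1 + Finsupp.single ⟨l, ⟨1, hl⟩⟩ 1)
        (Finsupp.single ⟨j, ⟨i + 1, hi⟩⟩ 1 + Finsupp.single ⟨l, ⟨0, by omega⟩⟩ 1) (by
          simp only [map_add, scrollGrading_single]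
          ext <;> simp)
      simp only [map_add, Finsupp.weight_single, one_smul] at this
      have ih := ih (by omega)
      push_cast
      linarith

theorem polytopeDim_of_isStatePolytope (k : Type*) [Field k] (hn : ∀ j, 1 ≤ n j)
    (hn' : ∃ j, 2 ≤ n j) {P : Set (Var n → ℝ)} (hP : IsStatePolytope (scrollIdeal k n) P) :
    polytopeDim P + (c + 1) = ∑ j, n j := by
  have hH := (isToric_scrollIdeal n k).sInter_groebnerFan (mem_range_affineWeight_iff n hn')
  rw [← hP.2] at hH
  have := polytopeDim_add_finrank hH
  rw [LinearMap.finrank_range_of_inj (affineWeight_injective n hn hn')] at this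
  simpa using this

end Dimension

/-! ### The degree of a scroll -/

section Hilbert

/-- The Hilbert function of a toric ideal counts the values of the grading on the exponents of a
given degree. -/
theorem IsToric.hilbertFunction_eq {σ k M : Type*} [Finite σ] [Field k] [AddMonoid M]
    {I : Ideal (MvPolynomial σ k)} {A : (σ →₀ ℕ) →+ M} (hI : IsToric I A) (m : ℕ) :
    hilbertFunction I m = Nat.card (A '' {u | u.degree = m}) := by
  classical
  have hfin : (A '' {u | u.degree = m}).Finite :=
    ((Finsupp.finite_of_degree_le m).subset fun u hu => le_of_eq hu).image _
  have := hfin.fintype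
  set V := MvPolynomial.homogeneousSubmodule σ k m
  -- Modulo `I`, a form of degree `m` is determined by its coefficient sums over the fibres.
  let L : V →ₗ[k] (A '' {u | u.degree = m} → k) :=
    LinearMap.pi fun b => (coeffSum k {u | A u = b}).domRestrict V
  have hL : ∀ f b, L f b = coeffSum k {u | A u = b} f := fun _ _ => rfl
  have hker : LinearMap.ker ((Ideal.Quotient.mkₐ k I).toLinearMap.domRestrict V)
      = LinearMap.ker L := by
    ext f
    rw [LinearMap.mem_ker, LinearMap.mem_ker, LinearMap.domRestrict_apply]
    change Ideal.Quotient.mk I (f : MvPolynomial σ k) = 0 ↔ _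
    rw [Ideal.Quotient.eq_zero_iff_mem, hI.mem_iff]
    constructor
    · intro h
      ext b
      exact h b
    · intro h b
      by_cases hb : b ∈ A '' {u | u.degree = m}
      · exact congrFun h ⟨b, hb⟩
      · rw [coeffSum_apply, Finset.sum_eq_zero]
        intro u hu
        rw [Finset.mem_filter, MvPolynomial.mem_support_iff] at hu
        have hd : u.degree = m := by
          rw [Finsupp.degree_eq_weight_one]
          exact f.2 hu.1
        exact (hb ⟨u, hd, hu.2⟩).elim
  have hsurj : Function.Surjective L := by
    intro g
    choose r hr hrA using fun b : A '' {u | u.degree = m} => b.2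
    refine ⟨⟨∑ b, MvPolynomial.monomial (r b) (g b), Submodule.sum_mem _ fun b _ =>
      MvPolynomial.isHomogeneous_monomial _ (hr b)⟩, ?_⟩
    ext b
    rw [hL, map_sum]
    simp only [coeffSum_monomial, Set.mem_ofPred_eq, hrA, Subtype.coe_inj]
    simp
  rw [hilbertFunction, ← LinearMap.range_domRestrict,
    ← ((Ideal.Quotient.mkₐ k I).toLinearMap.domRestrict V).quotKerEquivRange.finrank_eq, hker,
    (L.quotKerEquivOfSurjective hsurj).finrank_eq, Module.finrank_fintype_fun_eq_card,
    Nat.card_eq_fintype_card]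

variable {c : ℕ} (n : Fin c → ℕ)

theorem sum_scrollGrading_fst_mul (a : Fin c → ℕ) (u : Var n →₀ ℕ) :
    ∑ j, (scrollGrading n u).1 j * a j = ∑ p : Var n, u p * a p.1 := by
  simp only [scrollGrading_fst, Finset.sum_mul]
  rw [Finset.sum_comm]
  refine Finset.sum_congr rfl fun p _ => ?_
  simp [Pi.single_apply]

theorem degree_eq_sum_scrollGrading (u : Var n →₀ ℕ) :
    u.degree = ∑ j, (scrollGrading n u).1 j := by
  simpa [Finsupp.degree_eq_sum] using (sum_scrollGrading_fst_mul n 1 u).symm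

/-- Every position sum up to the maximal one occurs for given block degrees. -/
theorem exists_scrollGrading_eq (hn : ∀ j, 1 ≤ n j) (d : Fin c → ℕ) (t : ℕ)
    (ht : t ≤ ∑ j, d j * (n j - 1)) : ∃ u, scrollGrading n u = (d, t) := by
  classical
  induction t with
  | zero =>
    refine ⟨∑ j, d j • Finsupp.single ⟨j, ⟨0, hn j⟩⟩ 1, ?_⟩
    simp only [map_sum, map_nsmul, scrollGrading_single]
    ext j
    · simp [Prod.fst_sum, Finset.sum_apply, Pi.single_apply]
    · simp [Prod.snd_sum]
  | succ t ih =>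
    obtain ⟨u, hu⟩ := ih (by omega)
    -- If all variables were at the ends of their blocks, the sum would already be maximal.
    obtain ⟨⟨j, i⟩, hp, hi⟩ : ∃ p : Var n, u p ≠ 0 ∧ (p.2 : ℕ) + 1 < n p.1 := by
      by_contra! hcon
      have h₁ : ∑ p : Var n, u p * (p.2 : ℕ) = ∑ p : Var n, u p * (n p.1 - 1) := by
        refine Finset.sum_congr rfl fun p _ => ?_
        by_cases hp : u p = 0
        · simp [hp]
        · have := hcon p hp
          have := p.2.2
          rw [show (p.2 : ℕ) = n p.1 - 1 by omega]
      rw [← scrollGrading_snd, ← sum_scrollGrading_fst_mul n (fun j => n j - 1), hu] at h₁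
      simp only at h₁
      omega
    obtain ⟨e, rfl⟩ : ∃ e, u = e + Finsupp.single ⟨j, i⟩ 1 := by
      refine ⟨u - Finsupp.single ⟨j, i⟩ 1, (tsub_add_cancel_of_le ?_).symm⟩
      rw [Finsupp.single_le_iff]
      omega
    refine ⟨e + Finsupp.single ⟨j, ⟨i + 1, hi⟩⟩ 1, ?_⟩
    rw [map_add, scrollGrading_single] at hu ⊢
    rw [Prod.ext_iff] at hu ⊢
    refine ⟨hu.1, ?_⟩
    have := hu.2
    simp only [Prod.snd_add] at this ⊢
    omega

theorem hilbertFunction_scrollIdeal (k : Type*) [Field k] (hn : ∀ j, 1 ≤ n j) (m : ℕ) :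
    hilbertFunction (scrollIdeal k n) m
      = ∑ d ∈ Finset.piAntidiag Finset.univ m, (∑ j, d j * (n j - 1) + 1) := by
  classical
  have himage : scrollGrading n '' {u | u.degree = m} =
      (((Finset.piAntidiag Finset.univ m).sigma fun d : Fin c → ℕ =>
        Finset.range (∑ j, d j * (n j - 1) + 1)).map
          (Equiv.sigmaEquivProd (Fin c → ℕ) ℕ).toEmbedding : Set ((Fin c → ℕ) × ℕ)) := by
    ext ⟨d, t⟩
    simp only [Finset.coe_map, Set.mem_image, Finset.mem_coe, Finset.mem_sigma, Finset.mem_range,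
      Finset.mem_piAntidiag, Set.mem_ofPred_eq]
    constructor
    · rintro ⟨u, rfl, hu⟩
      refine ⟨⟨d, t⟩, ⟨⟨?_, by simp⟩, ?_⟩, rfl⟩
      · rw [degree_eq_sum_scrollGrading, hu]
      · have h₁ := sum_scrollGrading_fst_mul n (fun j => n j - 1) u
        have h₂ := scrollGrading_snd n u
        rw [hu] at h₁ h₂
        simp only at h₁ h₂ ⊢
        rw [Nat.lt_succ_iff, h₁, h₂]
        exact Finset.sum_le_sum fun p _ => Nat.mul_le_mul_left _ (by have := p.2.2; omega)
    · rintro ⟨⟨d', t'⟩, ⟨⟨hd, -⟩, ht⟩, h⟩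
      obtain ⟨rfl, rfl⟩ : d' = d ∧ t' = t := Prod.ext_iff.1 h
      obtain ⟨u, hu⟩ := exists_scrollGrading_eq n hn d' t' (Nat.lt_succ_iff.1 ht)
      exact ⟨u, by rw [degree_eq_sum_scrollGrading, hu]; exact hd, hu⟩
  rw [(isToric_scrollIdeal n k).hilbertFunction_eq, himage, Nat.card_coe_set_eq,
    Set.ncard_coe_finset, Finset.card_map, Finset.card_sigma]
  simp

theorem card_piAntidiag_univ_fin (c m : ℕ) :
    (Finset.piAntidiag (Finset.univ : Finset (Fin (c + 1))) m).card = (m + c).choose c := by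
  rw [← Finset.map_sym_eq_piAntidiag, Finset.card_map, Finset.sym_univ, Finset.card_univ,
    Sym.card_sym_eq_choose, Fintype.card_fin]
  rw [show c + 1 + m - 1 = m + c by omega, Nat.choose_symm_add]

/-- By symmetry, the coordinates of the compositions of `m` have average `m / c`. -/
theorem sum_piAntidiag_apply (m : ℕ) (j : Fin c) :
    c * ∑ d ∈ Finset.piAntidiag (Finset.univ : Finset (Fin c)) m, d j
      = m * (Finset.piAntidiag (Finset.univ : Finset (Fin c)) m).card := by
  classical
  have hsymm : ∀ l, ∑ d ∈ Finset.piAntidiag (Finset.univ : Finset (Fin c)) m, d l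
      = ∑ d ∈ Finset.piAntidiag (Finset.univ : Finset (Fin c)) m, d j := by
    intro l
    refine Finset.sum_nbij' (fun d => d ∘ Equiv.swap j l) (fun d => d ∘ Equiv.swap j l)
      ?_ ?_ ?_ ?_ ?_
    · intro d hd
      simp only [Finset.mem_piAntidiag, Finset.mem_univ, implies_true, and_true] at hd ⊢
      rw [← hd]
      exact Equiv.sum_comp (Equiv.swap j l) d
    · intro d hd
      simp only [Finset.mem_piAntidiag, Finset.mem_univ, implies_true, and_true] at hd ⊢
      rw [← hd]
      exact Equiv.sum_comp (Equiv.swap j l) d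
    · intro d _
      ext x
      simp
    · intro d _
      ext x
      simp
    · intro d _
      simp
  calc c * ∑ d ∈ Finset.piAntidiag (Finset.univ : Finset (Fin c)) m, d j
      = ∑ l : Fin c, ∑ d ∈ Finset.piAntidiag (Finset.univ : Finset (Fin c)) m, d l := by
        simp [hsymm]
    _ = ∑ d ∈ Finset.piAntidiag (Finset.univ : Finset (Fin c)) m, m := by
        rw [Finset.sum_comm]
        exact Finset.sum_congr rfl fun d hd => (Finset.mem_piAntidiag.1 hd).1
    _ = _ := by simp [mul_comm]

/-- The degree of a scroll is the sum of the degrees `n j - 1` of its rational normal curves. -/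
theorem hasProjectiveDegree_scrollIdeal (k : Type*) [Field k] (hn : ∀ j, 1 ≤ n j)
    (hn' : ∃ j, 2 ≤ n j) : HasProjectiveDegree (scrollIdeal k n) (∑ j, (n j - 1)) := by
  obtain ⟨c, rfl⟩ : ∃ b, c = b + 1 := by
    obtain ⟨j, -⟩ := hn'
    exact ⟨c - 1, by have := j.2; omega⟩
  set D := ∑ j, (n j - 1) with hD
  have hD0 : D ≠ 0 := by
    obtain ⟨j, hj⟩ := hn'
    have := Finset.single_le_sum (f := fun j => n j - 1) (fun _ _ => Nat.zero_le _)
      (Finset.mem_univ j)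
    omega
  have hc : ((c : ℚ) + 1) ≠ 0 := by positivity
  have hf : (c.factorial : ℚ) ≠ 0 := by positivity
  have ha : (D : ℚ) / (c + 1) ≠ 0 := div_ne_zero (by exact_mod_cast hD0) hc
  -- The Hilbert function at `m` is `(m + c).choose c * (1 + D * m / (c + 1))`.
  set q : Polynomial ℚ := (ascPochhammer ℚ c).comp (Polynomial.X + Polynomial.C 1) with hq
  have hqm : q.Monic := (monic_ascPochhammer ℚ c).comp (Polynomial.monic_X_add_C 1)
    (by rw [Polynomial.natDegree_X_add_C]; exact one_ne_zero)
  have hqd : q.natDegree = c := by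
    rw [hq, Polynomial.natDegree_comp, ascPochhammer_natDegree, Polynomial.natDegree_X_add_C,
      mul_one]
  set l : Polynomial ℚ := Polynomial.C ((D : ℚ) / (c + 1)) * Polynomial.X + Polynomial.C 1 with hl
  have hll : l.leadingCoeff = (D : ℚ) / (c + 1) := Polynomial.leadingCoeff_linear ha
  have hld : l.natDegree = 1 := Polynomial.natDegree_linear ha
  have hl0 : l ≠ 0 := by rintro h; rw [h] at hld; simp at hld
  refine ⟨Polynomial.C ((c.factorial : ℚ)⁻¹) * (q * l), Filter.Eventually.of_forall fun m => ?_, ?_⟩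
  · have hchoose : q.eval (m : ℚ) = c.factorial * ((m + c).choose c : ℚ) := by
      rw [hq, Polynomial.eval_comp, Polynomial.eval_add, Polynomial.eval_X, Polynomial.eval_C,
        ← Nat.cast_succ, ← ascPochhammer_eval_cast, ascPochhammer_nat_eq_ascFactorial,
        Nat.ascFactorial_eq_factorial_mul_choose]
      push_cast
      rfl
    have hcoord : ∀ j, ((∑ d ∈ Finset.piAntidiag (Finset.univ : Finset (Fin (c + 1))) m, d j : ℕ) :
        ℚ) = m * ((m + c).choose c : ℚ) / (c + 1) := by
      intro j
      rw [eq_div_iff hc, mul_comm]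
      have := sum_piAntidiag_apply m j
      rw [card_piAntidiag_univ_fin] at this
      exact_mod_cast this
    have hsum : ∑ d ∈ Finset.piAntidiag Finset.univ m, (∑ j, d j * (n j - 1) + 1)
        = ∑ j, (∑ d ∈ Finset.piAntidiag Finset.univ m, d j) * (n j - 1) + (m + c).choose c := by
      rw [Finset.sum_add_distrib, Finset.sum_comm, Finset.sum_const, card_piAntidiag_univ_fin,
        smul_eq_mul, mul_one]
      simp only [Finset.sum_mul]
    rw [hilbertFunction_scrollIdeal n k hn, hsum, Nat.cast_add, Nat.cast_sum]
    simp only [Nat.cast_mul, hcoord]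
    rw [← Finset.mul_sum, ← Nat.cast_sum, ← hD, Polynomial.eval_mul, Polynomial.eval_mul, hchoose,
      Polynomial.eval_C, hl, Polynomial.eval_add, Polynomial.eval_mul, Polynomial.eval_C,
      Polynomial.eval_C, Polynomial.eval_X]
    field_simp
  · rw [Polynomial.leadingCoeff_mul, Polynomial.leadingCoeff_mul, Polynomial.leadingCoeff_C,
      hqm.leadingCoeff, hll, Polynomial.natDegree_C_mul (inv_ne_zero hf),
      Polynomial.natDegree_mul hqm.ne_zero hl0, hqd, hld, Nat.factorial_succ]
    push_cast
    field_simp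

end Hilbert

end Scroll

theorem mainTheorem5 (k : Type*) [Field k] (c : ℕ) (n : Fin c → ℕ)
    (hn : ∀ j, 1 ≤ n j) (hn' : ∃ j, 2 ≤ n j) :
    (∃ P : Set (Scroll.Var n → ℝ), Scroll.IsStatePolytope (Scroll.scrollIdeal k n) P) ∧
    ∀ P : Set (Scroll.Var n → ℝ), Scroll.IsStatePolytope (Scroll.scrollIdeal k n) P →
      (Scroll.polytopeDim P : ℤ) = (∑ j, (n j : ℤ)) - c - 1 ∧
      Scroll.HasProjectiveDegree (Scroll.scrollIdeal k n) (Scroll.polytopeDim P + 1) := by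
  refine ⟨(Scroll.isToric_scrollIdeal n k).exists_isStatePolytope, fun P hP => ?_⟩
  have hdim := Scroll.polytopeDim_of_isStatePolytope n k hn hn' hP
  refine ⟨by rw [← Nat.cast_sum, ← hdim]; push_cast; ring, ?_⟩
  have hsum : ∑ j, (n j - 1) + c = ∑ j, n j := by
    have : ∑ j, (n j - 1 + 1) = ∑ j, n j :=
      Finset.sum_congr rfl fun j _ => Nat.sub_add_cancel (hn j)
    simpa [Finset.sum_add_distrib] using this
  rw [show Scroll.polytopeDim P + 1 = ∑ j, (n j - 1) by omega]
  exact Scroll.hasProjectiveDegree_scrollIdeal n k hn hn'
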